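/- Let $R$ be a discrete valuation ring of prime characteristic $p$ with fraction field $K$ and residue field $k$, let $\overline{K}$ be an algebraic closure of $K$, and let $\overline{\eta}$ be a geometric point $\operatorname{Spec}\Omega\to\operatorname{Spec}\overline{K}\to\operatorname{Spec}R$ over the generic point, with $\Omega$ an algebraically closed field. Let $\overline{k}$ be an algebraic closure of $k$. Then the completion $\widehat{R}$ of $R$ is isomorphic to $k[[t]]$, by an isomorphism compatible with the projections of $R$ to $k$. Moreover, for any ring isomorphism $\widehat{R}\cong k[[t]]$, with the resulting embedding $K\hookrightarrow k((t))$, and for any embeddings of algebraic closures $\overline{K}\hookrightarrow\overline{k((t))}\hookrightarrow\overline{\overline{k}((t))}$ that extend $K\hookrightarrow k((t))\hookrightarrow\overline{k}((t))$, the kernel of the canonical homomorphism $$\phi:\operatorname{Gal}_K=\operatorname{Gal}(\overline{K}/K)\longrightarrow\pi_1(\operatorname{Spec}R,\overline{\eta})$$ is the closed normal subgroup of $\operatorname{Gal}_K$ generated by the image of the composition $$\operatorname{Gal}_{\overline{k}((t))}\longrightarrow\operatorname{Gal}_{k((t))}\longrightarrow\operatorname{Gal}_K$$ of the restriction homomorphisms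 induced by these embeddings; that is, $\ker\phi$ is the smallest subgroup of $\operatorname{Gal}_K$ that contains this image, is normal, and is closed in the Krull topology. -/

import Mathlib

universe u

open CategoryTheory

open scoped PowerSeries LaurentSeries

noncomputable section

namespace KernelPi1

/-! ### The étale fundamental group of an affine scheme -/

/-- The étale fundamental group of `Spec R` at the geometric point `Spec Ω ⟶ Spec R`: the
automorphism group of the fibre functor `A ↦ Hom_R(A, Ω)` on finite étale `R`-algebras
(equivalently, on finite étale schemes `Spec A` over `Spec R`). -/
abbrev EtalePi1 (R : Type u) [CommRing R] (Ω : Type*) [Field Ω] [Algebra R Ω] :=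
  Aut (CommAlgCat.FiniteEtale.fiber.{u} R Ω)

section GalToPi1

variable (R : Type u) [CommRing R] (K Kb Ω : Type*) [Field K] [Field Kb] [Field Ω]
  [Algebra R K] [Algebra K Kb] [Algebra R Kb] [IsScalarTower R K Kb] [IsAlgClosed Kb]
  [Algebra Kb Ω] [Algebra R Ω] [IsScalarTower R Kb Ω]

/-- An `Ω`-point of a finite `R`-algebra takes values in the algebraically closed subfield `Kb`. -/
theorem mem_range_of_finite {A : Type*} [CommRing A] [Algebra R A] [Module.Finite R A]
    (f : A →ₐ[R] Ω) (a : A) : f a ∈ (IsScalarTower.toAlgHom R Kb Ω).range := by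
  have h : IsIntegral Kb (f a) := ((Algebra.IsIntegral.isIntegral (R := R) a).map f).tower_top
  obtain ⟨x, hx⟩ := h.mem_range_algebraMap_of_minpoly_splits (K := Kb)
    (by simpa using IsAlgClosed.splits (minpoly Kb (f a)))
  exact ⟨x, hx⟩

/-- For a finite `R`-algebra `A`, composition with `Kb → Ω` is a bijection from the `Kb`-points
of `A` to its `Ω`-points. -/
def pointsEquiv (A : Type*) [CommRing A] [Algebra R A] [Module.Finite R A] :
    (A →ₐ[R] Kb) ≃ (A →ₐ[R] Ω) :=
  Equiv.ofBijective (fun g => (IsScalarTower.toAlgHom R Kb Ω).comp g) (by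
    have hinj : Function.Injective (IsScalarTower.toAlgHom R Kb Ω) :=
      (algebraMap Kb Ω).injective
    refine ⟨fun g g' h => AlgHom.ext fun a => hinj (DFunLike.congr_fun h a), fun f => ?_⟩
    refine ⟨((AlgEquiv.ofInjective _ hinj).symm : _ →ₐ[R] Kb).comp
      (f.codRestrict _ (mem_range_of_finite R Kb Ω f)), AlgHom.ext fun a => ?_⟩
    exact congrArg Subtype.val ((AlgEquiv.ofInjective _ hinj).apply_symm_apply
      (f.codRestrict _ (mem_range_of_finite R Kb Ω f) a)))

theorem pointsEquiv_apply (A : Type*) [CommRing A] [Algebra R A] [Module.Finite R A]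
    (g : A →ₐ[R] Kb) (a : A) : pointsEquiv R Kb Ω A g a = algebraMap Kb Ω (g a) := rfl

/-- The action of `σ ∈ Gal(Kb/K)` on the `Ω`-points of a finite `R`-algebra `A`: an `Ω`-point
is a `Kb`-point `g : A → Kb`, which is sent to `σ ∘ g`. -/
def galPerm (A : Type*) [CommRing A] [Algebra R A] [Module.Finite R A] (σ : Kb ≃ₐ[K] Kb) :
    Equiv.Perm (A →ₐ[R] Ω) :=
  (pointsEquiv R Kb Ω A).symm.trans
    (((AlgEquiv.refl : A ≃ₐ[R] A).arrowCongr (σ.restrictScalars R)).trans (pointsEquiv R Kb Ω A))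

theorem galPerm_pointsEquiv (A : Type*) [CommRing A] [Algebra R A] [Module.Finite R A]
    (σ : Kb ≃ₐ[K] Kb) (g : A →ₐ[R] Kb) :
    galPerm R K Kb Ω A σ (pointsEquiv R Kb Ω A g) =
      pointsEquiv R Kb Ω A ((σ.restrictScalars R : Kb →ₐ[R] Kb).comp g) := by
  simp only [galPerm, Equiv.trans_apply, Equiv.symm_apply_apply]
  rfl

/-- The action of `Gal(Kb/K)` on the fibre functor at `Spec Ω → Spec Kb → Spec K → Spec R`, for
an algebraically closed extension `Kb` of `K`. -/
def galToPi1OfIsAlgClosed : (Kb ≃ₐ[K] Kb) →* EtalePi1 R Ω where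
  toFun σ := NatIso.ofComponents
    (fun A => FintypeCat.equivEquivIso (galPerm R K Kb Ω A.unop σ)) (by
      intro A B f
      ext x
      obtain ⟨g, rfl⟩ := (pointsEquiv R Kb Ω A.unop).surjective x
      change galPerm R K Kb Ω B.unop σ
          (pointsEquiv R Kb Ω B.unop (g.comp f.unop.hom.hom)) =
        (galPerm R K Kb Ω A.unop σ (pointsEquiv R Kb Ω A.unop g)).comp f.unop.hom.hom
      rw [galPerm_pointsEquiv, galPerm_pointsEquiv]
      rfl)
  map_one' := by
    apply Aut.ext
    ext A x
    obtain ⟨g, rfl⟩ := (pointsEquiv R Kb Ω A.unop).surjective x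
    change galPerm R K Kb Ω A.unop 1 (pointsEquiv R Kb Ω A.unop g) = pointsEquiv R Kb Ω A.unop g
    rw [galPerm_pointsEquiv]
    rfl
  map_mul' σ τ := by
    apply Aut.ext
    ext A x
    obtain ⟨g, rfl⟩ := (pointsEquiv R Kb Ω A.unop).surjective x
    change galPerm R K Kb Ω A.unop (σ * τ) (pointsEquiv R Kb Ω A.unop g) =
      galPerm R K Kb Ω A.unop σ (galPerm R K Kb Ω A.unop τ (pointsEquiv R Kb Ω A.unop g))
    rw [galPerm_pointsEquiv, galPerm_pointsEquiv, galPerm_pointsEquiv]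
    rfl

end GalToPi1

/-- The canonical homomorphism `Gal(Kb/K) → π₁(Spec R, Spec Ω)`, for an algebraic closure `Kb`
of `K` and a geometric point `Spec Ω → Spec Kb → Spec K → Spec R`. -/
def galToPi1 (R : Type u) [CommRing R] (K Kb Ω : Type*) [Field K] [Field Kb] [Field Ω]
    [Algebra R K] [Algebra K Kb] [Algebra R Kb] [IsScalarTower R K Kb] [IsAlgClosure K Kb]
    [Algebra Kb Ω] [Algebra R Ω] [IsScalarTower R Kb Ω] : (Kb ≃ₐ[K] Kb) →* EtalePi1 R Ω :=
  haveI : IsAlgClosed Kb := IsAlgClosure.isAlgClosed K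
  galToPi1OfIsAlgClosed R K Kb Ω

/-! ### Functoriality of Galois groups -/

/-- The homomorphism `Gal(Lb/L) → Gal(Kb/K)` attached to a commutative square of fields
`i : K → L`, `ω : Kb → Lb`, where `Kb` is an algebraic closure of `K`: it sends `σ` to the unique `τ` with `ω ∘ τ = σ ∘ ω`. -/
def galRestrict {K L Kb Lb : Type*} [Field K] [Field L] [Field Kb] [Field Lb]
    [Algebra K Kb] [Algebra L Lb] [IsAlgClosure K Kb] (i : K →+* L) (ω : Kb →+* Lb)
    (h : ω.comp (algebraMap K Kb) = (algebraMap L Lb).comp i) :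
    (Lb ≃ₐ[L] Lb) →* (Kb ≃ₐ[K] Kb) :=
  letI : Algebra K L := i.toAlgebra
  letI : Algebra Kb Lb := ω.toAlgebra
  letI : Algebra K Lb := ((algebraMap L Lb).comp i).toAlgebra
  haveI : IsScalarTower K L Lb := IsScalarTower.of_algebraMap_eq' rfl
  haveI : IsScalarTower K Kb Lb := IsScalarTower.of_algebraMap_eq' h.symm
  haveI : Normal K Kb := IsAlgClosure.normal K Kb
  (AlgEquiv.restrictNormalHom (F := K) (K₁ := Lb) Kb).comp (AlgEquiv.restrictScalarsHom K)

theorem galRestrict_apply {K L Kb Lb : Type*} [Field K] [Field L] [Field Kb] [Field Lb]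
    [Algebra K Kb] [Algebra L Lb] [IsAlgClosure K Kb] (i : K →+* L) (ω : Kb →+* Lb)
    (h : ω.comp (algebraMap K Kb) = (algebraMap L Lb).comp i) (σ : Lb ≃ₐ[L] Lb) (x : Kb) :
    ω (galRestrict i ω h σ x) = σ (ω x) := by
  let : Algebra K L := i.toAlgebra
  let : Algebra Kb Lb := ω.toAlgebra
  let : Algebra K Lb := ((algebraMap L Lb).comp i).toAlgebra
  have : IsScalarTower K L Lb := IsScalarTower.of_algebraMap_eq' rfl
  have : IsScalarTower K Kb Lb := IsScalarTower.of_algebraMap_eq' h.symm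
  have : Normal K Kb := IsAlgClosure.normal K Kb
  exact AlgEquiv.restrictNormal_commutes (σ.restrictScalars K) Kb x

/-! ### Laurent series and completions -/

/-- The coefficientwise homomorphism `k((t)) → l((t))` induced by `f : k → l`. -/
def laurentMap {k l : Type*} [Field k] [Field l] (f : k →+* l) : k⸨X⸩ →+* l⸨X⸩ where
  toFun x := HahnSeries.map x f
  map_one' := by
    ext n
    simp only [HahnSeries.map_coeff, HahnSeries.coeff_one]
    split_ifs <;> simp
  map_mul' x y := HahnSeries.map_mul (f : k →ₙ+* l)
  map_zero' := by ext n; simp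
  map_add' x y := by ext n; simp

variable (R : Type*) [CommRing R] [IsDomain R] [IsDiscreteValuationRing R]

/-- The completion of a discrete valuation ring. -/
abbrev Completion := AdicCompletion (IsLocalRing.maximalIdeal R) R

/-- The map from `R` to the Laurent series field over its residue field `k`, given by an
identification `e` of the completion of `R` with `k[[t]]`. -/
def toLaurent (e : Completion R ≃+* (IsLocalRing.ResidueField R)⟦X⟧) :
    R →+* (IsLocalRing.ResidueField R)⸨X⸩ :=
  (algebraMap (IsLocalRing.ResidueField R)⟦X⟧ (IsLocalRing.ResidueField R)⸨X⸩).comp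
    (e.toRingHom.comp (algebraMap R (Completion R)))

theorem toLaurent_injective (e : Completion R ≃+* (IsLocalRing.ResidueField R)⟦X⟧) :
    Function.Injective (toLaurent R e) :=
  (IsFractionRing.injective (IsLocalRing.ResidueField R)⟦X⟧
    (IsLocalRing.ResidueField R)⸨X⸩).comp
      (e.injective.comp (AdicCompletion.of_injective (IsLocalRing.maximalIdeal R) R))

/-- The induced embedding of the fraction field `K` of `R` in `k((t))`. -/
def fracToLaurent (K : Type*) [Field K] [Algebra R K] [IsFractionRing R K]
    (e : Completion R ≃+* (IsLocalRing.ResidueField R)⟦X⟧) :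
    K →+* (IsLocalRing.ResidueField R)⸨X⸩ :=
  IsFractionRing.lift (toLaurent_injective R e)

end KernelPi1

end

namespace KernelPi1

/-! An automorphism σ lies in ker φ exactly when it fixes every value of every `Kb`-point of a
finite étale R-algebra (`mem_ker_galToPi1`). Write l for the algebraic closure of k.

The image lies in the kernel because l[[t]] is complete with algebraically closed residue field: a
finite unramified domain over it is a quotient of it
(`algebraMap_surjective_of_formallyUnramified`). So étale points, seen in `Mb`, are power series,
which the Galois group of l((t)) fixes. The kernel is normal and closed, hence contains the closed
normal subgroup generated by the image.

Conversely, membership in a closure is tested on separable elements x fixed by the normal closure of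
the image. By normality the whole splitting field E of the minimal polynomial of x is fixed, so E
embeds in l((t)) and its integers in l[[t]]. A uniformizer of R stays a uniformizer there, so no
ramification index appears. If k is imperfect, the residue extension inside l might still be
inseparable; `mem_seriesOver_of_forall_pow` excludes this. For separable a, K(a) = K(a^(p^n)), and
comparing coefficients in the resulting identities forces the series of a to have coefficients
separable over k. Hence the integers of E are étale over R, and ker φ fixes x.

For the shape of the completion, k is formally smooth over the perfect field F_p, so k lifts to a
coefficient field, and series are evaluated at a uniformizer. -/

/-! ### Formal smoothness of field extensions of a perfect field -/

open MvPolynomial in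
-- Differentials over a field are projective, so only injectivity of I/I² → ⊕ k·dx_a matters, for
-- the presentation with one variable per element of k. This form concerns one polynomial at a time,
-- so it can be checked on finitely generated subfields.
theorem formallySmooth_iff_mem_ker_sq (F k : Type*) [Field F] [Field k] [Algebra F k] :
    Algebra.FormallySmooth F k ↔ ∀ f : MvPolynomial k F,
      aeval (R := F) (id : k → k) f = 0 → (∀ a, aeval (R := F) (id : k → k) (pderiv a f) = 0) →
        f ∈ RingHom.ker (aeval (R := F) (id : k → k)) ^ 2 := by
  have hs : Algebra.FormallySmooth F k ↔
      Function.Injective (Algebra.Generators.self F k).toExtension.cotangentComplex := by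
    rw [← Algebra.Extension.subsingleton_h1Cotangent]
    exact ⟨fun h => h.2, fun h => ⟨inferInstance, h⟩⟩
  have hd : ∀ f a, (Algebra.Generators.self F k).cotangentSpaceBasis.repr (1 ⊗ₜ .D _ _ f) a =
      aeval (R := F) (id : k → k) (pderiv a f) :=
    (Algebra.Generators.self F k).cotangentSpaceBasis_repr_one_tmul
  rw [hs, injective_iff_map_eq_zero]
  constructor
  · intro h f hf hfd
    have h0 := h (Algebra.Extension.Cotangent.mk ⟨f, hf⟩) (by
      rw [Algebra.Extension.cotangentComplex_mk]
      apply (Algebra.Generators.self F k).cotangentSpaceBasis.repr.injective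
      ext a
      rw [map_zero]
      exact (hd f a).trans (hfd a))
    have := congrArg Algebra.Extension.Cotangent.val h0
    exact (Ideal.toCotangent_eq_zero _ _).1 this
  · intro h x hx
    obtain ⟨⟨f, hf⟩, rfl⟩ := Algebra.Extension.Cotangent.mk_surjective x
    rw [Algebra.Extension.cotangentComplex_mk] at hx
    ext
    refine (Ideal.toCotangent_eq_zero _ _).2 (h f hf fun a => ?_)
    rw [← hd, hx, map_zero]
    rfl

open MvPolynomial in
theorem formallySmooth_of_forall_adjoin_finset (F k : Type*) [Field F] [Field k]
    [Algebra F k]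
    (h : ∀ s : Finset k, Algebra.FormallySmooth F (IntermediateField.adjoin F (s : Set k))) :
    Algebra.FormallySmooth F k := by
  rw [formallySmooth_iff_mem_ker_sq]
  intro f hf hfd
  obtain ⟨s, q, rfl⟩ := exists_finset_rename f
  let E := IntermediateField.adjoin F (s : Set k)
  let i : s → E := fun x => ⟨x.1, IntermediateField.subset_adjoin F _ x.2⟩
  have hv (g : MvPolynomial E F) : aeval (R := F) (id : k → k) (rename (Subtype.val : E → k) g) =
      (aeval (R := F) (id : E → E) g : E) := by
    rw [aeval_rename]
    exact (aeval_algebraMap_apply (B := k) (id : E → E) g)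
  -- The polynomial involves only the variables in `s`, so it comes from the presentation of F(s),
  -- where the criterion is available.
  have hq : rename (Subtype.val : s → k) q = rename (Subtype.val : E → k) (rename i q) := by
    rw [rename_rename]
    rfl
  rw [hq] at hf hfd ⊢
  have key := (formallySmooth_iff_mem_ker_sq F E).1 (h s) (rename i q)
    (Subtype.ext (by rw [← hv, hf]; rfl)) fun a => Subtype.ext (by
      rw [← hv, ← pderiv_rename Subtype.val_injective, hfd]; rfl)
  have := Ideal.mem_map_of_mem (rename (R := F) (Subtype.val : E → k)) key
  rw [Ideal.map_pow] at this
  refine Ideal.pow_right_mono (Ideal.map_le_iff_le_comap.2 fun g hg => ?_) 2 this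
  rw [Ideal.mem_comap, RingHom.mem_ker]
  change aeval (R := F) (id : k → k) (rename (Subtype.val : E → k) g) = 0
  rw [hv]
  exact congrArg Subtype.val (show aeval (R := F) (id : E → E) g = 0 from hg)

theorem formallySmooth_of_perfectField (F k : Type*) [Field F] [PerfectField F] [Field k]
    [Algebra F k] : Algebra.FormallySmooth F k := by
  refine formallySmooth_of_forall_adjoin_finset F k fun s => ?_
  have : Algebra.EssFiniteType F (IntermediateField.adjoin F (s : Set k)) :=
    (IntermediateField.essFiniteType_iff).2 ⟨s, rfl⟩
  infer_instance

/-! ### The completion as a power series ring -/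

/-- Evaluation of power series at an element of an ideal for which the target is complete. -/
theorem exists_powerSeries_eval {k S : Type*} [CommRing k] [CommRing S] (I : Ideal S)
    [IsAdicComplete I S] (c : k →+* S) {π : S} (hπ : π ∈ I) :
    ∃ f : k⟦X⟧ →+* S, (∀ a, f (PowerSeries.C a) = c a) ∧ f PowerSeries.X = π := by
  have hvan (n : ℕ) (P : Polynomial k) (hP : PowerSeries.trunc n (P : k⟦X⟧) = 0) :
      Ideal.Quotient.mk (I ^ n) (P.eval₂ c π) = 0 := by
    obtain ⟨Q, rfl⟩ : Polynomial.X ^ n ∣ P := by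
      rw [Polynomial.X_pow_dvd_iff]
      intro d hd
      have := congrArg (Polynomial.coeff · d) hP
      simpa [PowerSeries.coeff_trunc, hd] using this
    rw [Ideal.Quotient.eq_zero_iff_mem, Polynomial.eval₂_mul, Polynomial.eval₂_pow,
      Polynomial.eval₂_X]
    exact Ideal.mul_mem_right _ _ (Ideal.pow_mem_pow hπ n)
  have hcongr (n : ℕ) (P Q : Polynomial k)
      (h : PowerSeries.trunc n (P : k⟦X⟧) = PowerSeries.trunc n (Q : k⟦X⟧)) :
      Ideal.Quotient.mk (I ^ n) (P.eval₂ c π) = Ideal.Quotient.mk (I ^ n) (Q.eval₂ c π) := by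
    rw [← sub_eq_zero, ← map_sub, ← Polynomial.eval₂_sub]
    exact hvan n _ (by rw [Polynomial.coe_sub, map_sub, h, sub_self])
  -- Modulo `I ^ n` only the truncation matters, since X^n goes to `π ^ n`; the desired map is the
  -- limit of these.
  let g (n : ℕ) : k⟦X⟧ →+* S ⧸ I ^ n :=
    { toFun := fun f => Ideal.Quotient.mk (I ^ n) ((PowerSeries.trunc n f).eval₂ c π)
      map_one' := by
        rw [← map_one (Ideal.Quotient.mk (I ^ n)), ← Polynomial.eval₂_one c π]
        exact hcongr n _ _ (by rw [PowerSeries.trunc_trunc, Polynomial.coe_one])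
      map_mul' := fun f f' => by
        rw [← map_mul, ← Polynomial.eval₂_mul]
        exact hcongr n _ _ (by
          rw [PowerSeries.trunc_trunc, Polynomial.coe_mul, PowerSeries.trunc_trunc_mul_trunc])
      map_zero' := by simp
      map_add' := fun f f' => by simp [Polynomial.eval₂_add] }
  have hg (n : ℕ) (P : Polynomial k) :
      g n (P : k⟦X⟧) = Ideal.Quotient.mk (I ^ n) (P.eval₂ c π) :=
    hcongr n _ _ (by rw [PowerSeries.trunc_trunc])
  have hcompat {m n : ℕ} (hmn : m ≤ n) : (Ideal.Quotient.factorPow I hmn).comp (g n) = g m := by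
    ext f
    change Ideal.Quotient.factorPow I hmn (Ideal.Quotient.mk (I ^ n) _) =
      Ideal.Quotient.mk (I ^ m) _
    rw [Ideal.Quotient.factor_mk]
    exact hcongr m _ _ (by rw [PowerSeries.trunc_trunc_of_le _ hmn, PowerSeries.trunc_trunc])
  have hpoly : (fun P : Polynomial k => IsAdicComplete.liftRingHom I g hcompat (P : k⟦X⟧)) =
      fun P => P.eval₂ c π :=
    IsHausdorff.funext' I fun n P => by rw [IsAdicComplete.mk_liftRingHom, hg]
  refine ⟨IsAdicComplete.liftRingHom I g hcompat, fun a => ?_, ?_⟩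
  · simpa using congrFun hpoly (Polynomial.C a)
  · simpa using congrFun hpoly Polynomial.X

section Completion

open IsLocalRing

variable (R : Type*) [CommRing R] [IsDomain R] [IsDiscreteValuationRing R]

theorem maximalIdeal_completion_eq_span {ϖ : R} (hϖ : Irreducible ϖ) :
    maximalIdeal (Completion R) = Ideal.span {algebraMap R (Completion R) ϖ} := by
  have h : ((maximalIdeal R).map (algebraMap R (Completion R))) =
      (Ideal.span {ϖ}).map (algebraMap R (Completion R)) := congrArg _ hϖ.maximalIdeal_eq
  rw [AdicCompletion.maximalIdeal_eq_map, h, Ideal.map_span, Set.image_singleton]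

/-- A complete discrete valuation ring of prime characteristic is a power series ring over its
residue field. -/
theorem exists_completion_equiv_powerSeries (p : ℕ) [Fact p.Prime] [CharP R p] :
    ∃ e : Completion R ≃+* (ResidueField R)⟦X⟧, ∀ r : R,
      PowerSeries.constantCoeff (e (algebraMap R (Completion R) r)) = residue R r := by
  let _ : Algebra (ZMod p) R := ZMod.algebra R p
  obtain ⟨ϖ, hϖ⟩ := IsDiscreteValuationRing.exists_irreducible R
  have : Algebra.FormallySmooth (ZMod p) (R ⧸ maximalIdeal R) :=
    formallySmooth_of_perfectField (ZMod p) (ResidueField R)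
  -- Formal smoothness lifts the identity of the residue field to a coefficient field in the
  -- completion.
  obtain ⟨c, hc⟩ := Algebra.FormallySmooth.exists_adicCompletionEvalOneₐ_comp_eq
    (R := ZMod p) (A := R ⧸ maximalIdeal R) (S := R) (I := maximalIdeal R) (AlgHom.id _ _)
  have hm := maximalIdeal_completion_eq_span R hϖ
  let c' : ResidueField R →+* Completion R := c.toRingHom
  obtain ⟨f, hfC, hfX⟩ := exists_powerSeries_eval (maximalIdeal (Completion R)) c'
    (π := algebraMap R (Completion R) ϖ) (by rw [hm]; exact Ideal.mem_span_singleton_self _)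
  let q : Completion R →+* ResidueField R := (AdicCompletion.evalOneₐ (maximalIdeal R)).toRingHom
  have hqalg (r : R) : q (algebraMap R (Completion R) r) = residue R r := rfl
  have hqC (a : ResidueField R) : q (c' a) = a := DFunLike.congr_fun hc a
  have hqker : RingHom.ker q = maximalIdeal (Completion R) := by
    rw [AdicCompletion.maximalIdeal_eq_map]
    exact AdicCompletion.ker_evalOneₐ_eq_map _ (maximalIdeal R).fg_of_isNoetherianRing
  have hqf (x : (ResidueField R)⟦X⟧) : q (f x) = PowerSeries.constantCoeff x := by
    obtain ⟨y, hy⟩ : PowerSeries.X ∣ x - PowerSeries.C (PowerSeries.constantCoeff x) := by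
      rw [PowerSeries.X_dvd_iff]; simp
    have hϖ0 : q (algebraMap R (Completion R) ϖ) = 0 := by
      rw [← RingHom.mem_ker, hqker, hm]
      exact Ideal.mem_span_singleton_self _
    rw [sub_eq_iff_eq_add.1 hy, map_add, map_mul, map_add, map_mul, hfX, hϖ0, hfC]
    simpa using hqC _
  have hfm : (Ideal.span {PowerSeries.X}).map f = maximalIdeal (Completion R) := by
    rw [hm, Ideal.map_span, Set.image_singleton, hfX]
  have hsurj : Function.Surjective f := by
    have : IsHausdorff ((Ideal.span {PowerSeries.X}).map f) (Completion R) := by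
      rw [hfm]; infer_instance
    refine surjective_of_mk_map_comp_surjective (I := Ideal.span {PowerSeries.X}) f fun y => ?_
    obtain ⟨y, rfl⟩ := Ideal.Quotient.mk_surjective y
    refine ⟨PowerSeries.C (q y), ?_⟩
    rw [RingHom.comp_apply, Ideal.Quotient.mk_eq_mk_iff_sub_mem, hfm, ← hqker, RingHom.mem_ker,
      map_sub, hqf, PowerSeries.constantCoeff_C, sub_self]
  have hinj : Function.Injective f := by
    rw [injective_iff_map_eq_zero]
    intro x hx
    by_contra hx0
    obtain ⟨n, u, rfl⟩ := IsDiscreteValuationRing.eq_unit_mul_pow_irreducible hx0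
      PowerSeries.X_prime.irreducible
    rw [map_mul, map_pow, hfX, (u.isUnit.map f).mul_right_eq_zero, ← map_pow] at hx
    exact pow_ne_zero n hϖ.ne_zero
      (AdicCompletion.of_injective (maximalIdeal R) R (hx.trans (map_zero _).symm))
  refine ⟨(RingEquiv.ofBijective f ⟨hinj, hsurj⟩).symm, fun r => ?_⟩
  rw [← hqf, ← hqalg r]
  exact congrArg q ((RingEquiv.ofBijective f ⟨hinj, hsurj⟩).apply_symm_apply _)

end Completion

/-! ### Closures in the Krull topology -/

open scoped Topology in
/-- In a normal extension, the closure of a subgroup `H` contains every automorphism that fixes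
the separable elements fixed by `H`. -/
theorem mem_topologicalClosure_of_forall_isSeparable {K L : Type*} [Field K] [Field L]
    [Algebra K L] [Normal K L] (H : Subgroup (L ≃ₐ[K] L)) (σ : L ≃ₐ[K] L)
    (h : ∀ x : L, IsSeparable K x → (∀ τ ∈ H, τ x = x) → σ x = x) :
    σ ∈ H.topologicalClosure := by
  -- Some iterated Frobenius power of y is separable and still fixed by `H`; Frobenius is injective.
  have hfix (y : L) (hy : ∀ τ ∈ H, τ y = y) : σ y = y := by
    have := expChar_of_injective_algebraMap (algebraMap K L).injective (ringExpChar K)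
    obtain ⟨n, z, hz⟩ := IsPurelyInseparable.pow_mem (separableClosure K L) (ringExpChar K) y
    apply iterateFrobenius_inj L (ringExpChar K) n
    rw [iterateFrobenius_def, iterateFrobenius_def, ← map_pow]
    refine h _ ?_ fun τ hτ => by rw [map_pow, hy τ hτ]
    rw [← hz]
    exact mem_separableClosure_iff.1 z.2
  change σ ∈ closure (H : Set (L ≃ₐ[K] L))
  rw [mem_closure_iff_nhds]
  intro t ht
  have ht1 : (fun τ => σ * τ) ⁻¹' t ∈ 𝓝 (1 : L ≃ₐ[K] L) :=
    (continuous_const_mul σ).continuousAt.preimage_mem_nhds (by simpa using ht)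
  obtain ⟨F, _, _, hF⟩ := (krullTopology_mem_nhds_one_iff_of_normal K L _).1 ht1
  let r := AlgEquiv.restrictNormalHom (F := K) (K₁ := L) F
  have hr (τ : L ≃ₐ[K] L) (x : F) : (r τ x : L) = τ x := AlgEquiv.restrictNormal_commutes τ F x
  have hσ : r σ ∈ H.map r := by
    -- Artin's theorem at the finite level `F`, which need not be separable.
    rw [← IntermediateField.fixingSubgroup_fixedField (H.map r)]
    rintro ⟨x, hx⟩
    refine Subtype.ext ((hr σ x).trans (hfix x fun τ hτ => ?_))
    rw [← hr]
    exact congrArg Subtype.val (hx ⟨r τ, Subgroup.mem_map_of_mem r hτ⟩)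
  obtain ⟨τ, hτ, hτσ⟩ := hσ
  refine ⟨τ, ?_, hτ⟩
  have : σ⁻¹ * τ ∈ F.fixingSubgroup := by
    rintro x
    change σ⁻¹ (τ x) = x
    rw [← hr, hτσ, hr]
    exact σ.symm_apply_apply _
  simpa using hF this

/-- An automorphism-invariant separable element of a normal extension lies in the base field. -/
theorem mem_range_algebraMap_of_forall_fixed {K L : Type*} [Field K] [Field L]
    [Algebra K L] [Normal K L] {x : L} (hx : IsSeparable K x) (h : ∀ τ : L ≃ₐ[K] L, τ x = x) :
    x ∈ (algebraMap K L).range := by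
  by_contra hmem
  obtain ⟨y, hne, hy⟩ := (notMem_iff_exists_ne_and_isConjRoot hx (Normal.splits' x)).1 hmem
  obtain ⟨τ, hτ⟩ := isConjRoot_iff_exists_algEquiv.1 hy.symm
  exact hne ((h τ).symm.trans hτ)

/-! ### Finite unramified domains over a power series ring -/

/-- Separatedness is Krull's intersection theorem. The completion of M is a quotient of Ŝ ⊗ M, and S
already maps onto Ŝ. -/
theorem isAdicComplete_of_finite {S M : Type*} [CommRing S] [IsLocalRing S] [IsNoetherianRing S]
    (I : Ideal S) (hI : I ≠ ⊤) [IsAdicComplete I S] [AddCommGroup M] [Module S M]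
    [Module.Finite S M] : IsAdicComplete I M := by
  rw [← AdicCompletion.of_bijective_iff]
  have := IsHausdorff.of_isLocalRing (M := M) I hI
  refine ⟨AdicCompletion.of_injective I M, fun y => ?_⟩
  obtain ⟨z, rfl⟩ := AdicCompletion.ofTensorProduct_surjective_of_finite I M y
  induction z with
  | zero => exact ⟨0, by simp⟩
  | add z w hz hw =>
    obtain ⟨a, ha⟩ := hz
    obtain ⟨b, hb⟩ := hw
    exact ⟨a + b, by rw [map_add, map_add, ha, hb]⟩
  | tmul r m =>
    obtain ⟨s, rfl⟩ := AdicCompletion.of_surjective I S r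
    refine ⟨s • m, ?_⟩
    rw [AdicCompletion.ofTensorProduct_tmul, map_smul]
    rfl

theorem eq_zero_or_one_of_isIdempotentElem_quotient {D : Type*} [CommRing D] [IsDomain D]
    (J : Ideal D) [HenselianRing D J] {e : D ⧸ J} (he : IsIdempotentElem e) : e = 0 ∨ e = 1 := by
  obtain ⟨a, rfl⟩ := Ideal.Quotient.mk_surjective e
  have ha : a * a - a ∈ J := by
    rw [← Ideal.Quotient.eq_zero_iff_mem, map_sub, map_mul, he.eq, sub_self]
  let f : Polynomial D := Polynomial.X ^ 2 - Polynomial.X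
  have hf : f.Monic := (Polynomial.monic_X_pow 2).sub_of_left (by
    rw [Polynomial.degree_X_pow, Polynomial.degree_X]
    exact_mod_cast one_lt_two)
  have hfa (b : D) : f.eval b = b * b - b := by simp [f, sq]
  -- The derivative 2a - 1 of X² - X is its own inverse modulo `J`, so Hensel lifts the idempotent,
  -- even in characteristic 2.
  have hfd : f.derivative.eval a * (2 * a - 1) - 1 = 4 * (a * a - a) := by
    have : f.derivative.eval a = 2 * a - 1 := by simp [f, one_add_one_eq_two]
    rw [this]
    ring
  obtain ⟨b, hb, hba⟩ := HenselianRing.is_henselian (I := J) f hf a (by rwa [hfa]) (by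
    refine IsUnit.of_mul_eq_one (Ideal.Quotient.mk J (2 * a - 1)) ?_
    rw [← map_mul, ← map_one (Ideal.Quotient.mk J), Ideal.Quotient.mk_eq_mk_iff_sub_mem, hfd]
    exact Ideal.mul_mem_left _ _ ha)
  rw [← Ideal.Quotient.mk_eq_mk_iff_sub_mem] at hba
  have hb' : b * (b - 1) = 0 := by
    rw [mul_sub, mul_one, ← hfa]
    exact hb
  rw [← hba]
  rcases mul_eq_zero.1 hb' with h | h
  · left; rw [h, map_zero]
  · right; rw [sub_eq_zero.1 h, map_one]

/-- A finite unramified domain over the power series ring of an algebraically closed field is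
trivial. -/
theorem algebraMap_surjective_of_formallyUnramified {κ D : Type*} [Field κ] [IsAlgClosed κ]
    [CommRing D] [IsDomain D] [Algebra κ⟦X⟧ D] [Module.Finite κ⟦X⟧ D]
    [Algebra.FormallyUnramified κ⟦X⟧ D] : Function.Surjective (algebraMap κ⟦X⟧ D) := by
  let I : Ideal κ⟦X⟧ := Ideal.span {PowerSeries.X}
  have hI : I = IsLocalRing.maximalIdeal κ⟦X⟧ := PowerSeries.maximalIdeal_eq_span_X.symm
  have hItop : I ≠ ⊤ := by rw [hI]; exact Ideal.IsPrime.ne_top'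
  let J : Ideal D := I.map (algebraMap κ⟦X⟧ D)
  have : IsAdicComplete J D :=
    (IsAdicComplete.map_algebraMap_iff _ _).2 (isAdicComplete_of_finite I hItop)
  have hmax : I.IsMaximal := by rw [hI]; infer_instance
  let _ : Field (κ⟦X⟧ ⧸ I) := Ideal.Quotient.field I
  have : IsAlgClosed (κ⟦X⟧ ⧸ I) := by
    have hker : RingHom.ker (PowerSeries.constantCoeff (R := κ)) = I :=
      PowerSeries.ker_coeff_eq_max_ideal.trans hI.symm
    exact IsAlgClosed.of_ringEquiv κ _ ((Ideal.quotEquivOfEq hker).symm.trans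
      (RingHom.quotientKerEquivOfSurjective PowerSeries.constantCoeff_surj)).symm
  have : Algebra.FormallyUnramified (κ⟦X⟧ ⧸ I) (D ⧸ J) := inferInstance
  have : Module.Finite (κ⟦X⟧ ⧸ I) (D ⧸ J) := inferInstance
  have := Algebra.FormallyEtale.of_formallyUnramified_of_field (κ⟦X⟧ ⧸ I) (D ⧸ J)
  let φ := Algebra.FormallyEtale.equivPiOfIsSepClosed (κ⟦X⟧ ⧸ I) (D ⧸ J)
  -- The special fibre is a product of copies of the residue field. Two factors would give a
  -- nontrivial idempotent, which the henselian domain D does not allow.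
  have hsub : Subsingleton (PrimeSpectrum (D ⧸ J)) := by
    classical
    refine ⟨fun P Q => by_contra fun hPQ => ?_⟩
    have hid : IsIdempotentElem (φ.symm (Pi.single P 1)) := by
      rw [IsIdempotentElem, ← map_mul, ← Pi.single_mul, one_mul]
    rcases eq_zero_or_one_of_isIdempotentElem_quotient J hid with h | h
    · have := congrFun (φ.symm.injective (h.trans (map_zero φ.symm).symm)) P
      simp at this
    · have := congrFun (φ.symm.injective (h.trans (map_one φ.symm).symm)) Q
      simp [Ne.symm hPQ] at this
  refine surjective_of_mk_map_comp_surjective (I := I) _ fun y => ?_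
  have hsurj : Function.Surjective (algebraMap (κ⟦X⟧ ⧸ I) (D ⧸ J)) := by
    intro y
    obtain ⟨c, hc⟩ : ∃ c : κ⟦X⟧ ⧸ I, ∀ P, φ y P = c := by
      by_cases hne : Nonempty (PrimeSpectrum (D ⧸ J))
      · obtain ⟨P⟩ := hne
        exact ⟨φ y P, fun Q => by rw [Subsingleton.elim P Q]⟩
      · exact ⟨0, fun P => (hne ⟨P⟩).elim⟩
    refine ⟨c, φ.injective (funext fun P => ?_)⟩
    rw [hc, AlgEquiv.commutes]
    rfl
  obtain ⟨c, rfl⟩ := hsurj y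
  obtain ⟨c, rfl⟩ := Ideal.Quotient.mk_surjective c
  exact ⟨c, rfl⟩

/-! ### Coefficients of separable power series -/

section Coefficients

variable {κ : Type*} [Field κ]

/-- The power series with coefficients in a subfield. -/
noncomputable def seriesOver (S : Subfield κ) : Subring κ⟦X⟧ := (PowerSeries.map S.subtype).range

theorem mem_seriesOver {S : Subfield κ} {y : κ⟦X⟧} :
    y ∈ seriesOver S ↔ ∀ n, PowerSeries.coeff n y ∈ S := by
  constructor
  · rintro ⟨z, rfl⟩ n
    rw [PowerSeries.coeff_map]
    exact (PowerSeries.coeff n z).2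
  · intro h
    exact ⟨PowerSeries.mk fun n => ⟨_, h n⟩, by ext n; simp⟩

theorem seriesOver_mono {S T : Subfield κ} (h : S ≤ T) : seriesOver S ≤ seriesOver T :=
  fun _ hy => mem_seriesOver.2 fun n => h (mem_seriesOver.1 hy n)

theorem trunc_mem_seriesOver {S : Subfield κ} {y : κ⟦X⟧} {N : ℕ}
    (h : ∀ i < N, PowerSeries.coeff i y ∈ S) : (PowerSeries.trunc N y : κ⟦X⟧) ∈ seriesOver S := by
  refine mem_seriesOver.2 fun n => ?_
  rw [Polynomial.coeff_coe, PowerSeries.coeff_trunc]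
  split_ifs with hn
  · exact h n hn
  · exact S.zero_mem

/-- As r has order c, the coefficient of X^(N+c) in r·y is r_c·y_N plus terms in y_i with i < N. The
divisibility equates it with a coefficient of g, so one solves for y_N inside S. -/
theorem coeff_mem_of_dvd_mul_sub {S : Subfield κ} {y r g : κ⟦X⟧} {c N : ℕ}
    (hr : r ∈ seriesOver S) (hrc : PowerSeries.coeff c r ≠ 0)
    (hrc' : ∀ i < c, PowerSeries.coeff i r = 0) (hg : g ∈ seriesOver S)
    (hdvd : PowerSeries.X ^ (N + c + 1) ∣ r * y - g)
    (hy : ∀ i < N, PowerSeries.coeff i y ∈ S) : PowerSeries.coeff N y ∈ S := by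
  obtain ⟨w, hw⟩ : PowerSeries.X ^ N ∣ y - (PowerSeries.trunc N y : κ⟦X⟧) := by
    rw [PowerSeries.X_pow_dvd_iff]
    intro m hm
    simp [PowerSeries.coeff_trunc, hm]
  obtain ⟨s, rfl⟩ : PowerSeries.X ^ c ∣ r := PowerSeries.X_pow_dvd_iff.2 hrc'
  have hs : PowerSeries.coeff c (PowerSeries.X ^ c * s) = PowerSeries.coeff 0 s := by
    simpa using PowerSeries.coeff_X_pow_mul s c 0
  have hN : PowerSeries.coeff N y = PowerSeries.coeff 0 w := by
    rw [sub_eq_iff_eq_add.1 hw, map_add, Polynomial.coeff_coe, PowerSeries.coeff_trunc,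
      if_neg (lt_irrefl N), add_zero]
    simpa using PowerSeries.coeff_X_pow_mul w N 0
  have h1 := PowerSeries.X_pow_dvd_iff.1 hdvd (N + c) (Nat.lt_succ_self _)
  have h2 : PowerSeries.X ^ c * s * y - g = PowerSeries.X ^ (N + c) * (s * w) +
      (PowerSeries.X ^ c * s * (PowerSeries.trunc N y : κ⟦X⟧) - g) := by
    conv_lhs => rw [sub_eq_iff_eq_add.1 hw]
    ring
  have h3 : PowerSeries.coeff (N + c) (PowerSeries.X ^ (N + c) * (s * w)) =
      PowerSeries.coeff 0 s * PowerSeries.coeff 0 w := by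
    have := PowerSeries.coeff_X_pow_mul (s * w) (N + c) 0
    rw [zero_add] at this
    rw [this]
    simp
  have h4 := mem_seriesOver.1 ((seriesOver S).sub_mem ((seriesOver S).mul_mem hr
    (trunc_mem_seriesOver hy)) hg) (N + c)
  rw [h2, map_add, h3, ← hN, ← hs] at h1
  have h5 : PowerSeries.coeff c (PowerSeries.X ^ c * s) * PowerSeries.coeff N y ∈ S := by
    rw [eq_neg_of_add_eq_zero_left h1]
    exact S.neg_mem h4
  have h6 := S.mul_mem (S.inv_mem (mem_seriesOver.1 hr c)) h5
  rwa [inv_mul_cancel_left₀ hrc] at h6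

theorem exists_coeff_ne_zero {r : κ⟦X⟧} (hr : r ≠ 0) :
    ∃ c, PowerSeries.coeff c r ≠ 0 ∧ ∀ i < c, PowerSeries.coeff i r = 0 := by
  classical
  obtain ⟨c, hc⟩ := not_forall.1 (mt PowerSeries.ext hr)
  have h : ∃ c, PowerSeries.coeff c r ≠ 0 := ⟨c, hc⟩
  exact ⟨Nat.find h, Nat.find_spec h, fun i hi => not_not.1 (Nat.find_min h hi)⟩

theorem mem_seriesOver_of_mul_mem {S : Subfield κ} {y r : κ⟦X⟧} (hr0 : r ≠ 0)
    (hr : r ∈ seriesOver S) (h : r * y ∈ seriesOver S) : y ∈ seriesOver S := by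
  obtain ⟨c, hrc, hrc'⟩ := exists_coeff_ne_zero hr0
  refine mem_seriesOver.2 fun N => ?_
  induction N using Nat.strong_induction_on with
  | _ N ih => exact coeff_mem_of_dvd_mul_sub hr hrc hrc' h (by simp) ih

theorem eval_mem_subring {A : Type*} [CommRing A] (T : Subring A) {P : Polynomial A}
    (hP : ∀ i, P.coeff i ∈ T) {x : A} (hx : x ∈ T) : P.eval x ∈ T := by
  rw [Polynomial.eval_eq_sum_range]
  exact T.sum_mem fun i _ => T.mul_mem (hP i) (T.pow_mem hx i)

/-- If `y` is a rational expression in each `y ^ p ^ n` over the series with coefficients in `S`,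
and `κ` is purely inseparable over `S`, then the coefficients of `y` lie in `S`. -/
theorem mem_seriesOver_of_forall_pow (p : ℕ) [Fact p.Prime] [CharP κ p] {S : Subfield κ}
    (hS : ∀ z : κ, ∃ n, z ^ p ^ n ∈ S) {y : κ⟦X⟧}
    (h : ∀ n, ∃ (r : κ⟦X⟧) (P : Polynomial κ⟦X⟧), r ≠ 0 ∧ r ∈ seriesOver S ∧
      (∀ i, P.coeff i ∈ seriesOver S) ∧ r * y = P.eval (y ^ p ^ n)) : y ∈ seriesOver S := by
  have : CharP κ⟦X⟧ p := charP_of_injective_algebraMap (algebraMap κ κ⟦X⟧).injective p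
  -- `T n` consists of the p^n-th roots of S in κ. The case n = 1 first bounds the inseparability of
  -- all coefficients of y by a single n.
  let T (n : ℕ) : Subfield κ := S.comap (iterateFrobenius κ p n)
  have hT (n : ℕ) (z : κ) : z ∈ T n ↔ z ^ p ^ n ∈ S := Iff.rfl
  have hTmono : Monotone T := monotone_nat_of_le_succ fun n z hz => by
    rw [hT] at hz ⊢
    rw [pow_succ, pow_mul]
    exact S.pow_mem hz p
  have hST (n : ℕ) : S ≤ T n := fun z hz => S.pow_mem hz _
  obtain ⟨n, hn⟩ : ∃ n, y ∈ seriesOver (T n) := by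
    obtain ⟨r, P, hr0, hr, hP, hy⟩ := h 1
    rw [pow_one] at hy
    obtain ⟨c, hrc, hrc'⟩ := exists_coeff_ne_zero hr0
    choose m hm using hS
    refine ⟨(Finset.range (c + 1)).sup fun i => m (PowerSeries.coeff i y),
      mem_seriesOver.2 fun N => ?_⟩
    set n := (Finset.range (c + 1)).sup fun i => m (PowerSeries.coeff i y)
    induction N using Nat.strong_induction_on with
    | _ N ih =>
      rcases Nat.lt_or_ge c N with hN | hN
      · have hz := trunc_mem_seriesOver ih
        -- The first N coefficients determine y^p modulo X^(Np), and Np ≥ N + c + 1 once N > c. So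
        -- y_0, …, y_c determine all later coefficients.
        refine coeff_mem_of_dvd_mul_sub (g := P.eval ((PowerSeries.trunc N y : κ⟦X⟧) ^ p))
          (seriesOver_mono (hST n) hr) hrc hrc' (eval_mem_subring _
            (fun i => seriesOver_mono (hST n) (hP i)) (Subring.pow_mem _ hz p)) ?_ ih
        rw [hy]
        refine dvd_trans ?_ (P.sub_dvd_eval_sub _ _)
        rw [← sub_pow_char]
        have hdvd : PowerSeries.X ^ N ∣ y - (PowerSeries.trunc N y : κ⟦X⟧) := by
          rw [PowerSeries.X_pow_dvd_iff]
          intro i hi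
          simp [PowerSeries.coeff_trunc, hi]
        refine dvd_trans ?_ (pow_dvd_pow_of_dvd hdvd p)
        rw [← pow_mul]
        exact pow_dvd_pow _ (by nlinarith [(Fact.out : p.Prime).two_le])
      · exact hTmono (Finset.le_sup (f := fun i => m (PowerSeries.coeff i y))
          (Finset.mem_range.2 (Nat.lt_succ_of_le hN))) (hm _)
  -- With this n, y^(p^n) has coefficients in S, being the Frobenius twist of y expanded in X^(p^n);
  -- then so has y, by dividing by r.
  obtain ⟨r, P, hr0, hr, hP, hy⟩ := h n
  refine mem_seriesOver_of_mul_mem hr0 hr ?_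
  rw [hy]
  refine eval_mem_subring _ hP ?_
  refine mem_seriesOver.2 fun i => ?_
  have hexp : PowerSeries.map (iterateFrobenius κ p n)
      (PowerSeries.expand (p ^ n) (pow_ne_zero n (Fact.out : p.Prime).ne_zero) y) = y ^ p ^ n :=
    MvPowerSeries.map_iterateFrobenius_expand p (Fact.out : p.Prime).ne_zero y n
  rw [← hexp, PowerSeries.coeff_map, PowerSeries.coeff_expand]
  split_ifs with hi
  · exact mem_seriesOver.1 hn _
  · rw [map_zero]
    exact S.zero_mem

end Coefficients

/-! ### Unramified primes from embeddings in a power series ring -/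

section Unramified

variable {R A κ : Type*} [CommRing R] [CommRing A] [Algebra R A] [Field κ]

/-- The residue field of Q embeds in κ through c, and separability of a polynomial descends along
field maps. -/
theorem isSeparable_residueField_of_ringHom [Module.Finite R A] (p : Ideal R) [p.IsPrime]
    (Q : Ideal A) [Q.IsMaximal] [Q.LiesOver p]
    [Algebra (Localization.AtPrime p) (Localization.AtPrime Q)]
    [Localization.AtPrime.IsLiesOverAlgebra p Q]
    (c : A →+* κ) (hQ : Q = RingHom.ker c)
    (hsep : ∀ a : A, ∃ f : Polynomial R, (f.map (c.comp (algebraMap R A))).Separable ∧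
      (f.map (c.comp (algebraMap R A))).eval (c a) = 0) :
    Algebra.IsSeparable p.ResidueField Q.ResidueField := by
  let θ : Q.ResidueField →+* κ := Ideal.ResidueField.lift Q c hQ.le (by
    intro a ha
    refine isUnit_iff_ne_zero.2 fun h => ha ?_
    rw [hQ]
    exact h)
  have hθ (a : A) : θ (algebraMap A Q.ResidueField a) = c a :=
    Ideal.ResidueField.lift_algebraMap ..
  refine ⟨fun x => ?_⟩
  obtain ⟨a, rfl⟩ := Q.algebraMap_residueField_surjective x
  obtain ⟨f, hf, hfa⟩ := hsep a
  have hcomp : (θ.comp (algebraMap p.ResidueField Q.ResidueField)).comp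
      (algebraMap R p.ResidueField) = c.comp (algebraMap R A) := by
    ext r
    simp only [RingHom.comp_apply]
    rw [← hθ, ← IsScalarTower.algebraMap_apply R p.ResidueField Q.ResidueField,
      ← IsScalarTower.algebraMap_apply R A Q.ResidueField]
  rw [← hcomp, ← Polynomial.map_map] at hf hfa
  have hf' : (f.map (algebraMap R p.ResidueField)).Separable :=
    (Polynomial.separable_map _).1 hf
  refine hf'.of_dvd (minpoly.dvd _ _ (θ.injective ?_))
  rw [map_zero, Polynomial.aeval_def, Polynomial.hom_eval₂, ← Polynomial.eval_map, hθ]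
  exact hfa

/-- A prime ideal is unramified if it is the preimage of the maximal ideal under a homomorphism to
a power series ring that sends a uniformizer to a uniformizer and has separable residue
extension. -/
theorem isUnramifiedAt_of_ringHom_powerSeries [IsDomain R] [IsDiscreteValuationRing R]
    [IsDedekindDomain A] [Module.Finite R A] (ψ : A →+* κ⟦X⟧) (ϖ : R)
    (hψ : Associated (ψ (algebraMap R A ϖ)) PowerSeries.X)
    (hsep : ∀ a : A, ∃ f : Polynomial R,
      (f.map ((PowerSeries.constantCoeff.comp ψ).comp (algebraMap R A))).Separable ∧
      (f.map ((PowerSeries.constantCoeff.comp ψ).comp (algebraMap R A))).eval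
        (PowerSeries.constantCoeff (ψ a)) = 0)
    (Q : Ideal A) [Q.IsPrime] (hQ : Q = RingHom.ker (PowerSeries.constantCoeff.comp ψ)) :
    Algebra.IsUnramifiedAt R Q := by
  have hϖ0 : algebraMap R A ϖ ≠ 0 := by
    intro h
    rw [h, map_zero] at hψ
    exact PowerSeries.X_ne_zero (hψ.eq_zero_iff.1 rfl)
  have hϖQ : algebraMap R A ϖ ∈ Q := by
    obtain ⟨u, hu⟩ := hψ.symm
    rw [hQ, RingHom.mem_ker, RingHom.comp_apply, ← hu]
    simp
  have hQ0 : Q ≠ ⊥ := fun h => hϖ0 (by rw [h] at hϖQ; exact hϖQ)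
  have hQmax : Q.IsMaximal := Ideal.IsPrime.isMaximal ‹_› hQ0
  let p := Q.under R
  let _ := Localization.AtPrime.algebraOfLiesOver p Q
  rw [Algebra.isUnramifiedAt_iff_map_eq R p Q]
  refine ⟨isSeparable_residueField_of_ringHom p Q _ hQ hsep, ?_⟩
  have := IsLocalization.AtPrime.isDiscreteValuationRing_of_dedekind_domain A hQ0
    (Localization.AtPrime Q)
  have hunit (y : Q.primeCompl) : IsUnit (ψ y) := by
    rw [PowerSeries.isUnit_iff_constantCoeff, isUnit_iff_ne_zero]
    intro h
    exact y.2 (hQ.ge h)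
  let Ψ : Localization.AtPrime Q →+* κ⟦X⟧ := IsLocalization.lift hunit
  have hΨ (a : A) : Ψ (algebraMap A _ a) = ψ a := IsLocalization.lift_eq hunit a
  obtain ⟨t, ht⟩ := IsDiscreteValuationRing.exists_irreducible (Localization.AtPrime Q)
  have hmax := ht.maximalIdeal_eq
  have hϖm : algebraMap A (Localization.AtPrime Q) (algebraMap R A ϖ) ∈
      IsLocalRing.maximalIdeal (Localization.AtPrime Q) := by
    rw [← Localization.AtPrime.map_eq_maximalIdeal]
    exact Ideal.mem_map_of_mem _ hϖQ
  have hΨmax (x : Localization.AtPrime Q)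
      (hx : x ∈ IsLocalRing.maximalIdeal (Localization.AtPrime Q)) : ¬ IsUnit (Ψ x) := by
    rw [← Localization.AtPrime.map_eq_maximalIdeal] at hx
    have : (Q.map (algebraMap A (Localization.AtPrime Q))).map Ψ ≤
        RingHom.ker (PowerSeries.constantCoeff (R := κ)) := by
      rw [Ideal.map_map, Ideal.map_le_iff_le_comap]
      intro a ha
      rw [hQ] at ha
      rw [Ideal.mem_comap, RingHom.comp_apply, hΨ]
      exact ha
    rw [PowerSeries.isUnit_iff_constantCoeff, (this (Ideal.mem_map_of_mem _ hx) :)]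
    exact not_isUnit_zero
  apply le_antisymm
  · rw [Ideal.map_le_iff_le_comap]
    intro r hr
    rw [Ideal.mem_comap, IsScalarTower.algebraMap_apply R A (Localization.AtPrime Q),
      ← Localization.AtPrime.map_eq_maximalIdeal]
    exact Ideal.mem_map_of_mem _ hr
  · obtain ⟨s, hs⟩ := Ideal.mem_span_singleton.1 (hmax ▸ hϖm)
    -- The image of ϖ = t·s is irreducible in κ⟦X⟧ and `Ψ` sends nonunits to nonunits, so s is a
    -- unit and ϖ generates the maximal ideal.
    have hsu : IsUnit s := by
      by_contra hsn
      have hirr : Irreducible (Ψ t * Ψ s) := by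
        rw [← map_mul, ← hs, hΨ]
        exact hψ.symm.irreducible PowerSeries.X_prime.irreducible
      rcases hirr.isUnit_or_isUnit rfl with h | h
      · exact hΨmax t (by rw [hmax]; exact Ideal.mem_span_singleton_self t) h
      · exact hΨmax s ((IsLocalRing.mem_maximalIdeal s).2 hsn) h
    rw [hmax, Ideal.span_singleton_le_iff_mem]
    have hmem : t * s ∈ p.map (algebraMap R (Localization.AtPrime Q)) := by
      rw [← hs, ← IsScalarTower.algebraMap_apply]
      exact Ideal.mem_map_of_mem _ hϖQ
    exact (Ideal.mul_unit_mem_iff_mem _ hsu).1 hmem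

/-- The ring of integers of a finite Galois extension is étale over a discrete valuation ring if it
maps to a power series ring such that a uniformizer is sent to a uniformizer and the residue
extension is separable. -/
theorem etale_integralClosure_of_ringHom_powerSeries [IsDomain R] [IsDiscreteValuationRing R]
    (K E : Type*) [Field K] [Algebra R K] [IsFractionRing R K] [Field E] [Algebra K E]
    [Algebra R E] [IsScalarTower R K E] [FiniteDimensional K E] [IsGalois K E]
    (ψ : integralClosure R E →+* κ⟦X⟧) {ϖ : R} (hϖ : Irreducible ϖ)
    (hψ : Associated (ψ (algebraMap R _ ϖ)) PowerSeries.X)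
    (hsep : ∀ a, ∃ f : Polynomial R,
      (f.map ((PowerSeries.constantCoeff.comp ψ).comp (algebraMap R _))).Separable ∧
      (f.map ((PowerSeries.constantCoeff.comp ψ).comp (algebraMap R _))).eval
        (PowerSeries.constantCoeff (ψ a)) = 0) :
    Algebra.Etale R (integralClosure R E) := by
  let A := integralClosure R E
  have : IsDedekindDomain A := integralClosure.isDedekindDomain R K E
  have : Module.Finite R A := IsIntegralClosure.finite R K E A
  have : IsFractionRing A E := IsIntegralClosure.isFractionRing_of_finite_extension R K E A
  have : Finite (A ≃ₐ[R] A) := Finite.of_equiv _ (_root_.galRestrict R K E A).toEquiv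
  have : FaithfulSMul R A := (faithfulSMul_iff_algebraMap_injective R A).2 fun x y hxy =>
    ((algebraMap K E).injective.comp (IsFractionRing.injective R K)) (by
      simpa only [Function.comp_apply, ← IsScalarTower.algebraMap_apply] using
        congrArg (algebraMap A E) hxy)
  have : Module.Free R A := inferInstance
  have : Algebra.FinitePresentation R A := Algebra.FinitePresentation.of_finiteType.1 inferInstance
  have : Algebra.IsInvariant R A (A ≃ₐ[R] A) := Algebra.isInvariant_of_isGalois' R K E A
  have hunder (Q : Ideal A) [Q.IsPrime] (hQ : algebraMap R A ϖ ∈ Q) :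
      Q.under R = IsLocalRing.maximalIdeal R := by
    refine le_antisymm (IsLocalRing.le_maximalIdeal Ideal.IsPrime.ne_top') ?_
    rw [hϖ.maximalIdeal_eq, Ideal.span_singleton_le_iff_mem]
    exact hQ
  have hunr : Algebra.FormallyUnramified R A := by
    rw [Algebra.formallyUnramified_iff_forall]
    intro q
    obtain ⟨Q, hQ, hqQ⟩ := Ideal.exists_le_maximal q.asIdeal q.2.ne_top
    -- The ramified locus is a support, hence stable under specialization: maximal ideals suffice.
    suffices hu : Algebra.IsUnramifiedAt R Q by
      have hu' : (⟨Q, hQ.isPrime⟩ : PrimeSpectrum A) ∈ Algebra.unramifiedLocus R A := hu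
      change q ∈ Algebra.unramifiedLocus R A
      rw [Algebra.unramifiedLocus_eq_compl_support] at hu' ⊢
      exact fun h => hu' (Module.mem_support_mono hqQ h)
    let P : Ideal A := RingHom.ker (PowerSeries.constantCoeff.comp ψ)
    have hP : P.IsPrime := RingHom.ker_isPrime _
    have hϖP : algebraMap R A ϖ ∈ P := by
      obtain ⟨u, hu⟩ := hψ.symm
      change PowerSeries.constantCoeff (ψ (algebraMap R A ϖ)) = 0
      rw [← hu]
      simp
    have hQm : Q.under R = IsLocalRing.maximalIdeal R :=
      IsLocalRing.eq_maximalIdeal (Ideal.isMaximal_comap_of_isIntegral_of_isMaximal Q)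
    -- The Galois group permutes the primes over the maximal ideal transitively, so ψ twisted by σ⁻¹
    -- handles Q.
    obtain ⟨σ, hσ⟩ := Algebra.IsInvariant.exists_smul_of_under_eq R A (A ≃ₐ[R] A) P Q
      ((hunder P hϖP).trans hQm.symm)
    have hcomp : (ψ.comp (σ⁻¹ : A ≃ₐ[R] A).toRingHom).comp (algebraMap R A) =
        ψ.comp (algebraMap R A) := RingHom.ext fun r => congrArg ψ ((σ⁻¹).commutes r)
    refine isUnramifiedAt_of_ringHom_powerSeries (ψ.comp (σ⁻¹ : A ≃ₐ[R] A).toRingHom) ϖ ?_ ?_ Q ?_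
    · rw [← RingHom.comp_apply, hcomp]
      exact hψ
    · intro a
      rw [RingHom.comp_assoc, hcomp]
      exact hsep ((σ⁻¹ : A ≃ₐ[R] A) a)
    · ext a
      rw [hσ, Ideal.mem_pointwise_smul_iff_inv_smul_mem]
      rfl
  exact .of_formallyUnramified_of_flat

end Unramified

/-! ### Étale points as power series, and étaleness of subextensions of l((t)) -/

theorem exists_ringHom_comp_eq {A B C : Type*} [CommRing A] [CommRing B] [CommRing C]
    (f : A →+* C) (i : B →+* C) (hi : Function.Injective i) (h : ∀ a, f a ∈ i.range) :
    ∃ g : A →+* B, i.comp g = f := by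
  let e : B ≃+* i.range := RingEquiv.ofBijective i.rangeRestrict
    ⟨fun x y hxy => hi (congrArg Subtype.val hxy), i.rangeRestrict_surjective⟩
  exact ⟨(e.symm : i.range →+* B).comp (f.codRestrict i.range h), RingHom.ext fun a =>
    congrArg Subtype.val (e.apply_symm_apply (f.codRestrict i.range h a))⟩

/-- Points of finite unramified algebras in extensions of a power series ring over an
algebraically closed field are power series. -/
theorem mem_range_algebraMap_of_formallyUnramified {R A κ T : Type*} [CommRing R] [CommRing A]
    [Algebra R A] [Module.Finite R A] [Algebra.FormallyUnramified R A] [Field κ] [IsAlgClosed κ]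
    [Field T] [Algebra κ⟦X⟧ T] [Algebra R κ⟦X⟧] [Algebra R T] [IsScalarTower R κ⟦X⟧ T]
    (h : A →ₐ[R] T) (a : A) : h a ∈ (algebraMap κ⟦X⟧ T).range := by
  let φ : TensorProduct R κ⟦X⟧ A →ₐ[κ⟦X⟧] T :=
    Algebra.TensorProduct.lift (Algebra.ofId κ⟦X⟧ T) h fun _ _ => Commute.all _ _
  have : Module.Finite κ⟦X⟧ φ.range :=
    Module.Finite.of_surjective φ.rangeRestrict.toLinearMap φ.rangeRestrict_surjective
  -- The image of the base change in the field T is a finite unramified domain over κ⟦X⟧.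
  have : Algebra.FormallyUnramified κ⟦X⟧ φ.range :=
    Algebra.FormallyUnramified.of_surjective φ.rangeRestrict φ.rangeRestrict_surjective
  obtain ⟨s, hs⟩ := algebraMap_surjective_of_formallyUnramified (κ := κ)
    (⟨h a, 1 ⊗ₜ a, by simp [φ]⟩ : φ.range)
  exact ⟨s, congrArg Subtype.val hs⟩

/-- Separability gives K(a) = K(a^(p^n)); b clears the denominators. This supplies the identities
for `mem_seriesOver_of_forall_pow`. -/
theorem exists_smul_eq_aeval_pow_of_isSeparable {R K E : Type*} [CommRing R] [IsDomain R] [Field K]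
    [Algebra R K] [IsFractionRing R K] [Field E] [Algebra K E] [Algebra R E] [IsScalarTower R K E]
    (p : ℕ) [ExpChar K p] (n : ℕ) {a : E} (ha : IsSeparable K a) :
    ∃ (b : R) (P : Polynomial R), b ≠ 0 ∧ b • a = Polynomial.aeval (a ^ p ^ n) P := by
  have hmem : a ∈ IntermediateField.adjoin K {a ^ p ^ n} := by
    rw [← IntermediateField.adjoin_simple_eq_adjoin_pow_expChar_pow_of_isSeparable K E ha p n]
    exact IntermediateField.mem_adjoin_simple_self K a
  rw [← IntermediateField.mem_toSubalgebra,
    IntermediateField.adjoin_simple_toSubalgebra_of_isAlgebraic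
      (ha.isIntegral.pow _).isAlgebraic, Algebra.adjoin_singleton_eq_range_aeval] at hmem
  obtain ⟨P, hP⟩ := hmem
  obtain ⟨b, hb, hbP⟩ := IsLocalization.integerNormalization_spec (nonZeroDivisors R) P
  refine ⟨b, IsLocalization.integerNormalization (nonZeroDivisors R) P,
    nonZeroDivisors.ne_zero hb, ?_⟩
  rw [← Polynomial.aeval_map_algebraMap K, hbP, ← IsScalarTower.algebraMap_smul K b P, map_smul,
    IsScalarTower.algebraMap_smul]
  exact congrArg (b • ·) hP.symm

/-- A finite Galois extension of the fraction field of `R` that embeds in `l((t))`, for an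
algebraic extension `l` of the residue field, has étale ring of integers. -/
theorem etale_integralClosure_of_embedding {R : Type*} [CommRing R] [IsDomain R]
    [IsDiscreteValuationRing R] (K E : Type*) [Field K] [Algebra R K] [IsFractionRing R K]
    [Field E] [Algebra K E] [Algebra R E] [IsScalarTower R K E] [FiniteDimensional K E]
    [IsGalois K E] {k l : Type*} [Field k] [Field l] [Algebra k l] [Algebra.IsAlgebraic k l]
    (p : ℕ) [Fact p.Prime] [CharP R p] [CharP k p]
    (j : R →+* k⟦X⟧) {ϖ : R} (hϖ : Irreducible ϖ) (hj : Associated (j ϖ) PowerSeries.X)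
    (hjs : Function.Surjective (PowerSeries.constantCoeff.comp j)) (ρ : E →+* l⸨X⸩)
    (hρ : ∀ r, ρ (algebraMap R E r) =
      algebraMap l⟦X⟧ l⸨X⸩ (PowerSeries.map (algebraMap k l) (j r))) :
    Algebra.Etale R (integralClosure R E) := by
  have hinj : Function.Injective (algebraMap l⟦X⟧ l⸨X⸩) := IsFractionRing.injective _ _
  let J : R →+* l⟦X⟧ := (PowerSeries.map (algebraMap k l)).comp j
  have hJ : ρ.comp (algebraMap R E) = (algebraMap l⟦X⟧ l⸨X⸩).comp J := RingHom.ext hρ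
  have hRE : Function.Injective (algebraMap R E) := by
    rw [IsScalarTower.algebraMap_eq R K E]
    exact (algebraMap K E).injective.comp (IsFractionRing.injective R K)
  have hJinj : Function.Injective J := by
    have : Function.Injective (ρ.comp (algebraMap R E)) := ρ.injective.comp hRE
    rw [hJ, RingHom.coe_comp] at this
    exact this.of_comp
  obtain ⟨ψ, hψ⟩ := exists_ringHom_comp_eq (ρ.comp (algebraMap (integralClosure R E) E))
    (algebraMap l⟦X⟧ l⸨X⸩) hinj (fun a => by
      refine IsIntegrallyClosed.isIntegral_iff.1 ?_
      obtain ⟨P, hP, hPa⟩ := a.2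
      refine ⟨P.map J, hP.map J, ?_⟩
      rw [Polynomial.eval₂_map, ← hJ, RingHom.comp_apply, ← Polynomial.hom_eval₂]
      exact (congrArg ρ hPa).trans (map_zero ρ))
  have hψa (a : integralClosure R E) : algebraMap l⟦X⟧ l⸨X⸩ (ψ a) = ρ a :=
    DFunLike.congr_fun hψ a
  have hψJ : ψ.comp (algebraMap R (integralClosure R E)) = J := RingHom.ext fun r => hinj (by
    rw [RingHom.comp_apply, hψa]
    exact hρ r)
  have hψr (r : R) : ψ (algebraMap R _ r) = J r := DFunLike.congr_fun hψJ r
  let S : Subfield l := (separableClosure k l).toSubfield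
  have hJS (r : R) : J r ∈ seriesOver S := mem_seriesOver.2 fun n => by
    change PowerSeries.coeff n (PowerSeries.map (algebraMap k l) (j r)) ∈ separableClosure k l
    rw [PowerSeries.coeff_map]
    exact (separableClosure k l).algebraMap_mem _
  have : CharP l p := charP_of_injective_algebraMap (algebraMap k l).injective p
  have : CharP K p := charP_of_injective_algebraMap (IsFractionRing.injective R K) p
  have : ExpChar K p := ExpChar.prime Fact.out
  have : ExpChar k p := ExpChar.prime Fact.out
  have hψS (a : integralClosure R E) : ψ a ∈ seriesOver S := by
    refine mem_seriesOver_of_forall_pow p (fun z => ?_) fun n => ?_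
    · obtain ⟨n, w, hw⟩ := IsPurelyInseparable.pow_mem (separableClosure k l) p z
      exact ⟨n, hw ▸ w.2⟩
    · obtain ⟨b, P, hb, hbP⟩ := exists_smul_eq_aeval_pow_of_isSeparable (R := R) (K := K) p n
        (Algebra.IsSeparable.isSeparable K (a : E))
      refine ⟨J b, P.map J, (map_ne_zero_iff J hJinj).2 hb, hJS b, fun i => ?_, ?_⟩
      · rw [Polynomial.coeff_map]
        exact hJS _
      · rw [← hψr, ← map_mul, ← map_pow, Polynomial.eval_map, ← hψJ, ← Polynomial.hom_eval₂]
        refine congrArg ψ (Subtype.ext ?_)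
        rw [← Algebra.smul_def]
        refine hbP.trans ?_
        rw [← Polynomial.aeval_def]
        exact (Polynomial.aeval_algebraMap_apply E (a ^ p ^ n) P)
  refine etale_integralClosure_of_ringHom_powerSeries K E ψ hϖ ?_ fun a => ?_
  · rw [hψr]
    have := hj.map (PowerSeries.map (algebraMap k l))
    rwa [PowerSeries.map_X] at this
  · have hz : PowerSeries.constantCoeff (ψ a) ∈ separableClosure k l := by
      have := mem_seriesOver.1 (hψS a) 0
      rwa [PowerSeries.coeff_zero_eq_constantCoeff_apply] at this
    set z := PowerSeries.constantCoeff (ψ a)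
    -- Separability of z over k was the point of `hψS`; its minimal polynomial lifts to R because R
    -- maps onto k.
    obtain ⟨f, hf⟩ := Polynomial.map_surjective _ hjs (minpoly k z)
    have hc : (PowerSeries.constantCoeff.comp ψ).comp (algebraMap R (integralClosure R E)) =
        (algebraMap k l).comp (PowerSeries.constantCoeff.comp j) := by
      rw [RingHom.comp_assoc, hψJ]
      ext r
      have := PowerSeries.coeff_map (algebraMap k l) 0 (j r)
      rwa [PowerSeries.coeff_zero_eq_constantCoeff_apply,
        PowerSeries.coeff_zero_eq_constantCoeff_apply] at this
    have hfm : f.map ((PowerSeries.constantCoeff.comp ψ).comp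
        (algebraMap R (integralClosure R E))) = (minpoly k z).map (algebraMap k l) := by
      rw [hc, ← Polynomial.map_map, hf]
    refine ⟨f, ?_, ?_⟩
    · rw [hfm]
      exact Polynomial.Separable.map (mem_separableClosure_iff.1 hz)
    · rw [hfm, Polynomial.eval_map_algebraMap]
      exact minpoly.aeval k z

theorem laurentMap_algebraMap {k l : Type*} [Field k] [Field l] (f : k →+* l) (y : k⟦X⟧) :
    laurentMap f (algebraMap k⟦X⟧ k⸨X⸩ y) = algebraMap l⟦X⟧ l⸨X⸩ (PowerSeries.map f y) := by
  ext n
  change f ((algebraMap k⟦X⟧ k⸨X⸩ y).coeff n) = _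
  rw [LaurentSeries.coe_algebraMap, LaurentSeries.coe_algebraMap]
  change f ((y : k⸨X⸩).coeff n) = ((PowerSeries.map f y : l⟦X⟧) : l⸨X⸩).coeff n
  rw [PowerSeries.coeff_coe, PowerSeries.coeff_coe]
  split_ifs <;> simp

/-! ### The kernel in terms of points of finite étale algebras -/

section Kernel

variable (R : Type u) [CommRing R] (K Kb Ω : Type*) [Field K] [Field Kb] [Field Ω]
  [Algebra R K] [Algebra K Kb] [Algebra R Kb] [IsScalarTower R K Kb] [IsAlgClosure K Kb]
  [Algebra Kb Ω] [Algebra R Ω] [IsScalarTower R Kb Ω]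

theorem galToPi1_hom_app (A : Type u) [CommRing A] [Algebra R A] [Module.Finite R A]
    [Algebra.Etale R A] (σ : Kb ≃ₐ[K] Kb) (g : A →ₐ[R] Kb) :
    haveI : IsAlgClosed Kb := IsAlgClosure.isAlgClosed K
    (galToPi1 R K Kb Ω σ).hom.app (.op (.of R A)) (pointsEquiv R Kb Ω A g) =
      pointsEquiv R Kb Ω A ((σ.restrictScalars R : Kb →ₐ[R] Kb).comp g) := by
  have : IsAlgClosed Kb := IsAlgClosure.isAlgClosed K
  exact galPerm_pointsEquiv R K Kb Ω A σ g

theorem mem_ker_galToPi1 {σ : Kb ≃ₐ[K] Kb} : σ ∈ (galToPi1 R K Kb Ω).ker ↔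
    ∀ (A : Type u) [CommRing A] [Algebra R A] [Module.Finite R A] [Algebra.Etale R A]
      (g : A →ₐ[R] Kb) (a : A), σ (g a) = g a := by
  have : IsAlgClosed Kb := IsAlgClosure.isAlgClosed K
  rw [MonoidHom.mem_ker]
  constructor
  · intro h A _ _ _ _ g a
    have := galToPi1_hom_app R K Kb Ω A σ g
    rw [h] at this
    exact (DFunLike.congr_fun ((pointsEquiv R Kb Ω A).injective this) a).symm
  · intro h
    apply Aut.ext
    ext A x
    obtain ⟨g, rfl⟩ := (pointsEquiv R Kb Ω A.unop).surjective x
    refine (galPerm_pointsEquiv R K Kb Ω A.unop σ g).trans ?_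
    exact congrArg (pointsEquiv R Kb Ω A.unop) (AlgHom.ext (h A.unop g))

/-- An automorphism in the kernel fixes the points of finite étale algebras in any universe. -/
theorem apply_eq_of_mem_ker_galToPi1 {σ : Kb ≃ₐ[K] Kb} (hσ : σ ∈ (galToPi1 R K Kb Ω).ker)
    {A : Type*} [CommRing A] [Algebra R A] [Module.Finite R A] [Algebra.Etale R A]
    (g : A →ₐ[R] Kb) (a : A) : σ (g a) = g a := by
  obtain ⟨n, f, hf⟩ := Module.Finite.exists_fin' R A
  have : Small.{u} A := small_of_surjective hf
  let e : Shrink.{u} A ≃ₐ[R] A := Shrink.algEquiv R A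
  have : Module.Finite R (Shrink.{u} A) := Module.Finite.equiv e.symm.toLinearEquiv
  have : Algebra.Etale R (Shrink.{u} A) := Algebra.Etale.of_equiv e.symm
  have := (mem_ker_galToPi1 R K Kb Ω).1 hσ (Shrink.{u} A) (g.comp e) (e.symm a)
  simpa using this

/-- The kernel is an intersection of stabilizers of algebraic elements, which are open subgroups and
hence closed. -/
theorem isClosed_ker_galToPi1 : IsClosed ((galToPi1 R K Kb Ω).ker : Set (Kb ≃ₐ[K] Kb)) := by
  have : Algebra.IsAlgebraic K Kb := IsAlgClosure.isAlgebraic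
  have h : ((galToPi1 R K Kb Ω).ker : Set (Kb ≃ₐ[K] Kb)) =
      ⋂ x ∈ {x : Kb | ∀ σ ∈ (galToPi1 R K Kb Ω).ker, σ x = x},
        (MulAction.stabilizer (Kb ≃ₐ[K] Kb) x : Set (Kb ≃ₐ[K] Kb)) := by
    ext σ
    simp only [Set.mem_iInter]
    refine ⟨fun hσ x hx => hx σ hσ, fun h => (mem_ker_galToPi1 R K Kb Ω).2 ?_⟩
    intro A _ _ _ _ g a
    exact h (g a) fun τ hτ => (mem_ker_galToPi1 R K Kb Ω).1 hτ A g a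
  rw [h]
  exact isClosed_biInter fun x _ =>
    Subgroup.isClosed_of_isOpen _ (stabilizer_isOpen_of_isIntegral x)

end Kernel

/-! ### Arbitrary identifications of the completion with k[[t]] -/

section Completion

variable (R : Type*) [CommRing R] [IsDomain R] [IsDiscreteValuationRing R]
  {k : Type*} [Field k] (e : Completion R ≃+* k⟦X⟧)

/-- Any ring isomorphism of local rings matches the maximal ideals, so neither continuity nor
compatibility with the residue maps is needed. -/
theorem associated_completion_equiv_X {ϖ : R} (hϖ : Irreducible ϖ) :
    Associated (e (algebraMap R (Completion R) ϖ)) PowerSeries.X := by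
  have h : (IsLocalRing.maximalIdeal (Completion R)).map e =
      IsLocalRing.maximalIdeal k⟦X⟧ := IsLocalRing.map_ringEquiv_maximalIdeal e
  rw [maximalIdeal_completion_eq_span R hϖ, Ideal.map_span, Set.image_singleton,
    PowerSeries.maximalIdeal_eq_span_X] at h
  exact Ideal.span_singleton_eq_span_singleton.1 h

theorem constantCoeff_completion_equiv_surjective : Function.Surjective
    (PowerSeries.constantCoeff.comp (e.toRingHom.comp (algebraMap R (Completion R)))) := by
  intro c
  obtain ⟨r, hr⟩ := (AdicCompletion.residueField_map_bijective R).2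
    (IsLocalRing.residue _ (e.symm (PowerSeries.C c)))
  obtain ⟨r, rfl⟩ := IsLocalRing.residue_surjective r
  refine ⟨r, ?_⟩
  rw [IsLocalRing.ResidueField.map_residue, ← sub_eq_zero, ← map_sub,
    IsLocalRing.residue_eq_zero_iff, ← IsLocalRing.map_ringEquiv_maximalIdeal e.symm,
    Ideal.map_symm, Ideal.mem_comap, map_sub, PowerSeries.maximalIdeal_eq_span_X,
    Ideal.mem_span_singleton, PowerSeries.X_dvd_iff] at hr
  simpa [sub_eq_zero] using hr

end Completion

/-! ### The two inclusions -/

section Main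

variable {R : Type u} [CommRing R] {K Kb : Type*} (Ω : Type*) [Field K] [Field Kb] [Field Ω]
  [Algebra R K] [Algebra K Kb] [Algebra R Kb] [IsScalarTower R K Kb] [IsAlgClosure K Kb]
  [Algebra Kb Ω] [Algebra R Ω] [IsScalarTower R Kb Ω]
  {l Mb : Type*} [Field l] [IsAlgClosed l] [Field Mb] [Algebra l⸨X⸩ Mb] {ι : Kb →+* Mb}
  {G : (Mb ≃ₐ[l⸨X⸩] Mb) →* (Kb ≃ₐ[K] Kb)}

theorem range_le_ker_galToPi1 (J : R →+* l⟦X⟧)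
    (hι : ∀ r, ι (algebraMap R Kb r) = algebraMap l⸨X⸩ Mb (algebraMap l⟦X⟧ l⸨X⸩ (J r)))
    (hG : ∀ τ x, ι (G τ x) = τ (ι x)) : G.range ≤ (galToPi1 R K Kb Ω).ker := by
  rintro _ ⟨τ, rfl⟩
  rw [mem_ker_galToPi1]
  intro A _ _ _ _ g a
  apply ι.injective
  rw [hG]
  let : Algebra R l⟦X⟧ := J.toAlgebra
  let : Algebra l⟦X⟧ Mb := ((algebraMap l⸨X⸩ Mb).comp (algebraMap l⟦X⟧ l⸨X⸩)).toAlgebra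
  let : Algebra R Mb := (ι.comp (algebraMap R Kb)).toAlgebra
  have : IsScalarTower R l⟦X⟧ Mb := IsScalarTower.of_algebraMap_eq hι
  let ι' : Kb →ₐ[R] Mb := { ι with commutes' := fun _ => rfl }
  obtain ⟨s, hs⟩ := mem_range_algebraMap_of_formallyUnramified (κ := l) (ι'.comp g) a
  have hs : algebraMap l⸨X⸩ Mb (algebraMap l⟦X⟧ l⸨X⸩ s) = ι (g a) := hs
  rw [← hs, τ.commutes]

theorem closure_range_le_ker_galToPi1 (J : R →+* l⟦X⟧)
    (hι : ∀ r, ι (algebraMap R Kb r) = algebraMap l⸨X⸩ Mb (algebraMap l⟦X⟧ l⸨X⸩ (J r)))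
    (hG : ∀ τ x, ι (G τ x) = τ (ι x)) :
    (Subgroup.normalClosure (G.range : Set (Kb ≃ₐ[K] Kb))).topologicalClosure ≤
      (galToPi1 R K Kb Ω).ker :=
  Subgroup.topologicalClosure_minimal _
    (Subgroup.normalClosure_le_normal (range_le_ker_galToPi1 Ω J hι hG))
    (isClosed_ker_galToPi1 R K Kb Ω)

end Main

/-- The elements fixed by a normal subgroup contain the splitting field of the minimal polynomial
of each of them. -/
theorem apply_eq_of_mem_adjoin_rootSet {K L : Type*} [Field K] [Field L] [Algebra K L]
    [Normal K L] (H : Subgroup (L ≃ₐ[K] L)) [H.Normal] {x : L} (hx : ∀ τ ∈ H, τ x = x)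
    {y : L} (hy : y ∈ IntermediateField.adjoin K ((minpoly K x).rootSet L))
    {τ : L ≃ₐ[K] L} (hτ : τ ∈ H) : τ y = y := by
  suffices h : IntermediateField.adjoin K ((minpoly K x).rootSet L) ≤
      IntermediateField.fixedField H from h hy ⟨τ, hτ⟩
  rw [IntermediateField.adjoin_le_iff]
  rintro z hz ⟨τ, hτ⟩
  obtain ⟨g, rfl⟩ := minpoly.exists_algEquiv_of_root'
    (Algebra.IsAlgebraic.isAlgebraic x) (Polynomial.aeval_eq_zero_of_mem_rootSet hz)
  -- The conjugate g⁻¹τg lies in `H` and fixes x, so τ fixes the conjugate root g x.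
  have := congrArg g (hx _ (‹H.Normal›.conj_mem τ hτ g⁻¹))
  rwa [inv_inv, AlgEquiv.mul_apply, AlgEquiv.mul_apply, AlgEquiv.aut_inv,
    AlgEquiv.apply_symm_apply] at this

theorem _root_.IsSeparable.map_ringHom {K L M N : Type*} [Field K] [Field L] [Algebra K L]
    [Field M] [Field N] [Algebra M N] {i : K →+* M} {ι : L →+* N}
    (hi : ∀ x, ι (algebraMap K L x) = algebraMap M N (i x)) {y : L} (hy : IsSeparable K y) :
    IsSeparable M (ι y) := by
  refine Polynomial.Separable.of_dvd (Polynomial.Separable.map (f := i) hy) ?_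
  refine minpoly.dvd _ _ ?_
  rw [Polynomial.aeval_def, Polynomial.eval₂_map,
    ← show ι.comp (algebraMap K L) = (algebraMap M N).comp i from RingHom.ext hi,
    ← Polynomial.hom_eval₂, ← Polynomial.aeval_def, minpoly.aeval, map_zero]

/-- The kernel acts trivially on the finite Galois subextensions whose image in `Mb` is fixed by
the absolute Galois group of `l((t))`. -/
theorem apply_eq_of_mem_ker_of_forall_fixed (p : ℕ) [Fact p.Prime] {R : Type u} [CommRing R] [IsDomain R]
    [IsDiscreteValuationRing R] [CharP R p] {K Kb : Type*} (Ω : Type*) [Field K] [Field Kb]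
    [Field Ω] [Algebra R K] [IsFractionRing R K] [Algebra K Kb] [Algebra R Kb]
    [IsScalarTower R K Kb] [IsAlgClosure K Kb] [Algebra Kb Ω] [Algebra R Ω] [IsScalarTower R Kb Ω]
    {k l Mb : Type*} [Field k] [CharP k p] [Field l] [Algebra k l] [Algebra.IsAlgebraic k l]
    [Field Mb] [Algebra l⸨X⸩ Mb] [Normal l⸨X⸩ Mb] {ι : Kb →+* Mb}
    (i : K →+* l⸨X⸩) (hi : ∀ x, ι (algebraMap K Kb x) = algebraMap l⸨X⸩ Mb (i x))
    (j : R →+* k⟦X⟧) {ϖ : R} (hϖ : Irreducible ϖ) (hj : Associated (j ϖ) PowerSeries.X)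
    (hjs : Function.Surjective (PowerSeries.constantCoeff.comp j))
    (hij : ∀ r, i (algebraMap R K r) =
      algebraMap l⟦X⟧ l⸨X⸩ (PowerSeries.map (algebraMap k l) (j r)))
    (E : IntermediateField K Kb) [FiniteDimensional K E]
    [IsGalois K E] (hE : ∀ y ∈ E, ∀ τ : Mb ≃ₐ[l⸨X⸩] Mb, τ (ι y) = ι y)
    {σ : Kb ≃ₐ[K] Kb} (hσ : σ ∈ (galToPi1 R K Kb Ω).ker) {x : Kb} (hx : x ∈ E) : σ x = x := by
  have : IsScalarTower R E Kb := IsScalarTower.of_algebraMap_eq fun _ => rfl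
  have hsep (y : E) : IsSeparable l⸨X⸩ (ι y) :=
    ((Algebra.IsSeparable.isSeparable K y).map E.val E.val.injective).map_ringHom hi
  obtain ⟨ρ, hρ⟩ := exists_ringHom_comp_eq (ι.comp (algebraMap E Kb)) (algebraMap l⸨X⸩ Mb)
    (algebraMap l⸨X⸩ Mb).injective
    fun y => mem_range_algebraMap_of_forall_fixed (hsep y) (hE y y.2)
  have hρR (r : R) : ρ (algebraMap R E r) =
      algebraMap l⟦X⟧ l⸨X⸩ (PowerSeries.map (algebraMap k l) (j r)) := by
    apply (algebraMap l⸨X⸩ Mb).injective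
    rw [← hij, ← hi]
    refine (DFunLike.congr_fun hρ (algebraMap R E r)).trans (congrArg ι ?_)
    rw [← IsScalarTower.algebraMap_apply, ← IsScalarTower.algebraMap_apply]
  have := etale_integralClosure_of_embedding K E p j hϖ hj hjs ρ hρR
  have : Module.Finite R (integralClosure R E) := IsIntegralClosure.finite R K E _
  -- A nonzero multiple of x by an element of R is integral, hence a value of an étale point; r is
  -- then cancelled.
  obtain ⟨r, hr, hint⟩ := IsAlgebraic.exists_integral_multiple
    ((IsFractionRing.isAlgebraic_iff R K E).2 (Algebra.IsAlgebraic.isAlgebraic (⟨x, hx⟩ : E)))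
  have h := apply_eq_of_mem_ker_galToPi1 R K Kb Ω hσ
    ((IsScalarTower.toAlgHom R E Kb).comp (integralClosure R E).val) ⟨_, hint⟩
  have h : σ (r • x) = r • x := h
  have hr' : algebraMap R K r ≠ 0 :=
    (map_ne_zero_iff _ (IsFractionRing.injective R K)).2 hr
  rw [← IsScalarTower.algebraMap_smul K r x, map_smul] at h
  exact smul_right_injective Kb hr' h

/-- Passing to the normal closure is what makes the fixed field contain full splitting fields, so
that the Galois case `apply_eq_of_mem_ker_of_forall_fixed` applies. -/
theorem ker_galToPi1_le_closure_range (p : ℕ) [Fact p.Prime] {R : Type u} [CommRing R] [IsDomain R]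
    [IsDiscreteValuationRing R] [CharP R p] {K Kb : Type*} (Ω : Type*) [Field K] [Field Kb]
    [Field Ω] [Algebra R K] [IsFractionRing R K] [Algebra K Kb] [Algebra R Kb]
    [IsScalarTower R K Kb] [IsAlgClosure K Kb] [Algebra Kb Ω] [Algebra R Ω] [IsScalarTower R Kb Ω]
    {k l Mb : Type*} [Field k] [CharP k p] [Field l] [Algebra k l] [Algebra.IsAlgebraic k l]
    [Field Mb] [Algebra l⸨X⸩ Mb] [Normal l⸨X⸩ Mb] {ι : Kb →+* Mb}
    (i : K →+* l⸨X⸩) (hi : ∀ x, ι (algebraMap K Kb x) = algebraMap l⸨X⸩ Mb (i x))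
    (j : R →+* k⟦X⟧) {ϖ : R} (hϖ : Irreducible ϖ) (hj : Associated (j ϖ) PowerSeries.X)
    (hjs : Function.Surjective (PowerSeries.constantCoeff.comp j))
    (hij : ∀ r, i (algebraMap R K r) =
      algebraMap l⟦X⟧ l⸨X⸩ (PowerSeries.map (algebraMap k l) (j r)))
    {G : (Mb ≃ₐ[l⸨X⸩] Mb) →* (Kb ≃ₐ[K] Kb)}
    (hG : ∀ τ x, ι (G τ x) = τ (ι x)) : (galToPi1 R K Kb Ω).ker ≤
      (Subgroup.normalClosure (G.range : Set (Kb ≃ₐ[K] Kb))).topologicalClosure := by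
  intro σ hσ
  have : Normal K Kb := IsAlgClosure.normal K Kb
  refine mem_topologicalClosure_of_forall_isSeparable _ σ fun x hx hfix => ?_
  have hsplit : (minpoly K x).IsSplittingField K
      (IntermediateField.adjoin K ((minpoly K x).rootSet Kb)) :=
    IntermediateField.adjoin_rootSet_isSplittingField (Normal.splits' x)
  have : IsGalois K (IntermediateField.adjoin K ((minpoly K x).rootSet Kb)) :=
    IsGalois.of_separable_splitting_field hx
  have : FiniteDimensional K (IntermediateField.adjoin K ((minpoly K x).rootSet Kb)) :=
    Polynomial.IsSplittingField.finiteDimensional _ (minpoly K x)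
  refine apply_eq_of_mem_ker_of_forall_fixed p Ω i hi j hϖ hj hjs hij
    (IntermediateField.adjoin K ((minpoly K x).rootSet Kb)) (fun y hy τ => ?_) hσ
    (IntermediateField.subset_adjoin _ _
      (Polynomial.mem_rootSet.2 ⟨minpoly.ne_zero hx.isIntegral, minpoly.aeval K x⟩))
  rw [← hG, apply_eq_of_mem_adjoin_rootSet _ hfix hy (Subgroup.subset_normalClosure ⟨τ, rfl⟩)]

end KernelPi1

theorem mainTheorem4 (p : ℕ) [Fact p.Prime]
    -- a discrete valuation ring `R` of characteristic `p` with fraction field `K`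
    (R : Type*) [CommRing R] [IsDomain R] [IsDiscreteValuationRing R] [CharP R p]
    (K : Type*) [Field K] [Algebra R K] [IsFractionRing R K]
    -- an algebraic closure `Kb` of `K`, and a geometric point `Spec Ω → Spec Kb → Spec R`
    -- over the generic point
    (Kb : Type*) [Field Kb] [Algebra K Kb] [IsAlgClosure K Kb]
    [Algebra R Kb] [IsScalarTower R K Kb]
    (Ω : Type*) [Field Ω] [IsAlgClosed Ω] [Algebra Kb Ω] [Algebra R Ω] [IsScalarTower R Kb Ω]
    -- an algebraic closure `kb` of the residue field `k`
    (kb : Type*) [Field kb] [Algebra (IsLocalRing.ResidueField R) kb]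
    [IsAlgClosure (IsLocalRing.ResidueField R) kb]
    -- algebraic closures `Lb` of `L = k((t))` and `Mb` of `M = kb((t))`
    (Lb : Type*) [Field Lb] [Algebra (IsLocalRing.ResidueField R)⸨X⸩ Lb]
    [IsAlgClosure (IsLocalRing.ResidueField R)⸨X⸩ Lb]
    (Mb : Type*) [Field Mb] [Algebra kb⸨X⸩ Mb] [IsAlgClosure kb⸨X⸩ Mb] :
    -- the completion of `R` is of the form `k[[t]]`
    (∃ e : KernelPi1.Completion R ≃+* (IsLocalRing.ResidueField R)⟦X⟧,
      ∀ r : R, PowerSeries.constantCoeff (e (algebraMap R (KernelPi1.Completion R) r)) =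
        IsLocalRing.residue R r) ∧
    -- and, for every such identification and every choice of embeddings of algebraic closures,
    -- the kernel is the closed normal subgroup generated by the image
    ∀ (e : KernelPi1.Completion R ≃+* (IsLocalRing.ResidueField R)⟦X⟧)
      (ω : Kb →+* Lb)
      (hω : ω.comp (algebraMap K Kb) =
        (algebraMap (IsLocalRing.ResidueField R)⸨X⸩ Lb).comp (KernelPi1.fracToLaurent R K e))
      (ω' : Lb →+* Mb)
      (hω' : ω'.comp (algebraMap (IsLocalRing.ResidueField R)⸨X⸩ Lb) =
        (algebraMap kb⸨X⸩ Mb).comp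
          (KernelPi1.laurentMap (algebraMap (IsLocalRing.ResidueField R) kb))),
      (KernelPi1.galToPi1 R K Kb Ω).ker =
        (Subgroup.normalClosure
          (((KernelPi1.galRestrict (KernelPi1.fracToLaurent R K e) ω hω).comp
            (KernelPi1.galRestrict
              (KernelPi1.laurentMap (algebraMap (IsLocalRing.ResidueField R) kb)) ω' hω')).range :
            Set (Kb ≃ₐ[K] Kb))).topologicalClosure := by
  refine ⟨KernelPi1.exists_completion_equiv_powerSeries R p, fun e ω hω ω' hω' => ?_⟩
  have : IsAlgClosed kb := IsAlgClosure.isAlgClosed (IsLocalRing.ResidueField R)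
  have : Algebra.IsAlgebraic (IsLocalRing.ResidueField R) kb := IsAlgClosure.isAlgebraic
  have : Normal kb⸨X⸩ Mb := IsAlgClosure.normal kb⸨X⸩ Mb
  have : CharP (IsLocalRing.ResidueField R) p :=
    (CharP.charP_iff_prime_eq_zero Fact.out).2 (by
      rw [← map_natCast (algebraMap R (IsLocalRing.ResidueField R)), CharP.cast_eq_zero, map_zero])
  obtain ⟨ϖ, hϖ⟩ := IsDiscreteValuationRing.exists_irreducible R
  let i : K →+* kb⸨X⸩ := (KernelPi1.laurentMap (algebraMap (IsLocalRing.ResidueField R) kb)).comp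
    (KernelPi1.fracToLaurent R K e)
  let j : R →+* (IsLocalRing.ResidueField R)⟦X⟧ :=
    e.toRingHom.comp (algebraMap R (KernelPi1.Completion R))
  have hi (x : K) : (ω'.comp ω) (algebraMap K Kb x) = algebraMap kb⸨X⸩ Mb (i x) :=
    (congrArg ω' (DFunLike.congr_fun hω x)).trans (DFunLike.congr_fun hω' _)
  have hij (r : R) : i (algebraMap R K r) = algebraMap kb⟦X⟧ kb⸨X⸩
      (PowerSeries.map (algebraMap (IsLocalRing.ResidueField R) kb) (j r)) := by
    rw [← KernelPi1.laurentMap_algebraMap]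
    exact congrArg (KernelPi1.laurentMap (algebraMap (IsLocalRing.ResidueField R) kb))
      (IsFractionRing.lift_algebraMap (K := K) (KernelPi1.toLaurent_injective R e) r)
  have hG (τ : Mb ≃ₐ[kb⸨X⸩] Mb) (x : Kb) : (ω'.comp ω)
      (((KernelPi1.galRestrict (KernelPi1.fracToLaurent R K e) ω hω).comp
        (KernelPi1.galRestrict (KernelPi1.laurentMap
          (algebraMap (IsLocalRing.ResidueField R) kb)) ω' hω')) τ x) = τ ((ω'.comp ω) x) := by
    rw [RingHom.comp_apply, MonoidHom.comp_apply, KernelPi1.galRestrict_apply,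
      KernelPi1.galRestrict_apply, RingHom.comp_apply]
  refine le_antisymm ?_ ?_
  · exact KernelPi1.ker_galToPi1_le_closure_range p Ω i hi j hϖ
      (KernelPi1.associated_completion_equiv_X R e hϖ)
      (KernelPi1.constantCoeff_completion_equiv_surjective R e) hij hG
  · refine KernelPi1.closure_range_le_ker_galToPi1 Ω
      ((PowerSeries.map (algebraMap (IsLocalRing.ResidueField R) kb)).comp j) (fun r => ?_) hG
    rw [IsScalarTower.algebraMap_apply R K Kb, hi, hij]
    rfl
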